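/- Let $d\ge 1$ and let $\mathcal M_d$ be the space of complex $d\times d$ matrices with the Hilbert–Schmidt inner product $\langle A,B\rangle=\mathrm{Tr}[A^\dagger B]$; adjoints $L^*$ and singular values of linear maps $\mathcal M_d\to\mathcal M_d$ refer to this inner product. For $\mathcal L\in\mathcal M_d$ let $D_{\mathcal L}(\rho)=\mathcal L\rho\mathcal L^\dagger-\tfrac12(\mathcal L^\dagger\mathcal L\rho+\rho\mathcal L^\dagger\mathcal L)$. A Lindblad generator is a linear map $L:\mathcal M_d\to\mathcal M_d$ of the form $$L(\rho)=i(\rho H-H\rho)+\sum_{j=1}^{n}D_{\mathcal L_j}(\rho)$$ with $H=H^\dagger\in\mathcal M_d$, $n\ge 0$ and $\mathcal L_1,\dots,\mathcal L_n\in\mathcal M_d$. Let $\mathcal I_d$ be the set of linear maps $T:\mathcal M_d\to\mathcal M_d$ such that for every $\varepsilon>0$ there are finitely many Lindblad generators $G_1,\dots,G_n$ with $\|e^{G_j}-\mathrm{id}\|\le\varepsilon$ for all $j$ and $\prod_{j=1}^n e^{G_j}=T$. The elements of the closure $\overline{\mathcal I}_d$ are called infinitesimal Markovian divisible quantum channels.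 Then every $T\in\overline{\mathcal I}_d$ satisfies $$0\le\det T\le\big(s_1^\uparrow(T)\big)^{d/2},$$ where $s_1^\uparrow(T)$ is the smallest of the $d^2$ singular values of $T$ (and, in particular, $\det T$ is real). Moreover, for every $\mathcal L\in\mathcal M_d$ the generator $L=D_{\mathcal L}$ satisfies $$\mathrm{Tr}[L+L^*]\le\frac d2\,\Lambda_{\min}(L+L^*),$$ where $\Lambda_{\min}(L+L^*)$ is the smallest eigenvalue of the self-adjoint map $L+L^*$ on $\mathcal M_d$. -/

import Mathlib

open scoped Matrix ComplexOrder

/-- The linear maps that, for every `ε > 0`, are finite products of exponentials of elements of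
`𝒢`, each factor being `ε`-close to the identity. -/
def infinitesimalProducts {E : Type*} [NormedAddCommGroup E] [NormedSpace ℂ E]
    (𝒢 : Set (E →L[ℂ] E)) : Set (E →L[ℂ] E) :=
  {T | ∀ ε : ℝ, 0 < ε → ∃ (n : ℕ) (G : Fin n → E →L[ℂ] E),
    (∀ j, G j ∈ 𝒢) ∧ (∀ j, ‖NormedSpace.exp (G j) - 1‖ ≤ ε) ∧
      (List.ofFn fun j => NormedSpace.exp (G j)).prod = T}

/-- The linear maps that are infinitesimal Markovian divisible with respect to `𝒢`. -/
def infinitesimalDivisible {E : Type*} [NormedAddCommGroup E] [NormedSpace ℂ E]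
    (𝒢 : Set (E →L[ℂ] E)) : Set (E →L[ℂ] E) :=
  closure (infinitesimalProducts 𝒢)

/-- Linear maps `M_d → M_d` on the complex `d × d` matrices. -/
abbrev Superoperator (d : ℕ) : Type :=
  Matrix (Fin d) (Fin d) ℂ →ₗ[ℂ] Matrix (Fin d) (Fin d) ℂ

/-- The complex `d × d` matrices as a Hilbert space, with the entries as coordinates. -/
abbrev HilbertSchmidt (d : ℕ) : Type := EuclideanSpace ℂ (Fin d × Fin d)

/-- The vectorization of a matrix. -/
noncomputable def vectorize (d : ℕ) : Matrix (Fin d) (Fin d) ℂ ≃ₗ[ℂ] HilbertSchmidt d where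
  toFun A := WithLp.toLp 2 fun p => A p.1 p.2
  invFun v := Matrix.of fun i j => v (i, j)
  map_add' _ _ := rfl
  map_smul' _ _ := rfl
  left_inv _ := rfl
  right_inv _ := rfl

/-- Through the vectorization, the inner product is the Hilbert-Schmidt one, `Tr[Aᴴ B]`. -/
theorem inner_vectorize {d : ℕ} (A B : Matrix (Fin d) (Fin d) ℂ) :
    inner ℂ (vectorize d A) (vectorize d B) = (Aᴴ * B).trace := by
  simp only [vectorize, PiLp.inner_apply, Matrix.trace, Matrix.diag_apply,
    Matrix.mul_apply, Matrix.conjTranspose_apply, Fintype.sum_prod_type]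
  rw [Finset.sum_comm]
  refine Finset.sum_congr rfl fun i _ => Finset.sum_congr rfl fun j _ => ?_
  exact mul_comm _ _

/-- A linear map `M_d → M_d` as an operator on the Hilbert space of `d × d` matrices. -/
noncomputable def toHilbertSchmidt {d : ℕ} (T : Superoperator d) :
    HilbertSchmidt d →L[ℂ] HilbertSchmidt d :=
  LinearMap.toContinuousLinearMap ((vectorize d).conj T)

/-- The purely dissipative generator with one Lindbladian `A`:
`ρ ↦ A ρ A† - ½ {A† A, ρ}`. -/
noncomputable def dissipator {d : ℕ} (A : Matrix (Fin d) (Fin d) ℂ) : Superoperator d where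
  toFun ρ := A * ρ * Aᴴ - (1 / 2 : ℂ) • (Aᴴ * A * ρ + ρ * (Aᴴ * A))
  map_add' ρ σ := by
    simp only [mul_add, add_mul, smul_add]
    abel
  map_smul' c ρ := by
    simp only [mul_smul_comm, smul_mul_assoc, smul_sub, smul_add, RingHom.id_apply,
      smul_comm c (1 / 2 : ℂ)]

/-- Lindblad (GKLS) generators:
`L ρ = i [ρ, H] + ∑ j, (A j ρ (A j)† - ½ {(A j)† (A j), ρ})` with `H` self-adjoint. -/
def IsLindbladGenerator {d : ℕ} (L : Superoperator d) : Prop :=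
  ∃ (H : Matrix (Fin d) (Fin d) ℂ) (n : ℕ) (A : Fin n → Matrix (Fin d) (Fin d) ℂ),
    H.IsHermitian ∧
      ∀ ρ, L ρ = Complex.I • (ρ * H - H * ρ) + ∑ j, dissipator (A j) ρ

/-- The infinitesimal Markovian divisible quantum channels on `d × d` matrices: the maps that are
infinitesimal Markovian divisible with respect to the set of all Lindblad generators. -/
def IsInfinitesimalMarkovianDivisible {d : ℕ} (T : Superoperator d) : Prop :=
  toHilbertSchmidt T ∈
    infinitesimalDivisible (toHilbertSchmidt '' {L : Superoperator d | IsLindbladGenerator L})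

/-- The `i`-th smallest singular value of `T : M_d → M_d`, for `1 ≤ i ≤ d ^ 2`. Mathlib lists the
`d ^ 2` singular values in decreasing order, starting at index `0`. -/
noncomputable def singularValueUp {d : ℕ} (T : Superoperator d) (i : ℕ) : ℝ :=
  (toHilbertSchmidt T).toLinearMap.singularValues (d ^ 2 - i)

/-- The map `L + L*`, where `L*` is the Hilbert-Schmidt adjoint. -/
noncomputable def addAdjoint {d : ℕ} (L : Superoperator d) :
    HilbertSchmidt d →ₗ[ℂ] HilbertSchmidt d :=
  (toHilbertSchmidt L).toLinearMap + LinearMap.adjoint (toHilbertSchmidt L).toLinearMap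

/-!
Both claims rest on one inequality for a Lindblad generator `L` on `d × d` matrices: `tr L` is real
and `(2 / d) (tr L) ‖X‖² ≤ Re ⟪X, L X⟫` for all `X`, in the Hilbert-Schmidt inner product
(`isTraceBounded_lindbladGenerator`). The inequality is additive in `L`. A commutator with a
skew-adjoint matrix satisfies it trivially, since both sides vanish. For `L = D_A`, replacing `A` by
its traceless part changes `D_A` by such a commutator only (`dissipator_add_smul_one`), so let
`tr A = 0`. Then `tr D_A = -d ‖A‖²` (`trace_dissipator`), while `‖D_A X‖ ≤ 2 ‖A‖² ‖X‖` because the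
Frobenius norm is submultiplicative (`norm_dissipator_apply_le`); Cauchy-Schwarz gives the claim.

For the eigenvalue bound, evaluate the inequality at an eigenvector of `L + L*`
(`IsTraceBounded.trace_add_adjoint_le`).

For the determinant bound, integrate it along `t ↦ e ^ (t L) X`: this gives
`‖e ^ L X‖ ≥ e ^ ((2 / d) tr L) ‖X‖` (`exp_mul_norm_le_norm_exp_apply`), and
`e ^ (tr L) = det e ^ L` (`det_exp_eq_exp_trace`). Hence `T = e ^ L` satisfies `det T ≥ 0` and
`‖T X‖ ≥ (det T) ^ (2 / d) ‖X‖`. These conditions are stable under products and closed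
(`infinitesimalDivisible_subset`), so they hold for every infinitesimal Markovian divisible map. A
right singular vector `X` for the smallest singular value turns them into the stated bound.
-/

open scoped InnerProductSpace Matrix.Norms.Frobenius

/-! ### The determinant of an exponential -/

section DetExp

variable {E : Type*} [NormedAddCommGroup E] [NormedSpace ℂ E] [FiniteDimensional ℂ E]

theorem differentiable_linearMap_det :
    Differentiable ℂ fun f : E →L[ℂ] E => LinearMap.det (f : E →ₗ[ℂ] E) := by
  let b := Module.finBasis ℂ E
  have h : (fun f : E →L[ℂ] E => LinearMap.det (f : E →ₗ[ℂ] E)) = fun f : E →L[ℂ] E =>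
      (LinearMap.toMatrix b b (f : E →ₗ[ℂ] E)).det := by
    funext f
    rw [LinearMap.det_toMatrix]
  have hentry : ∀ i j, Differentiable ℂ fun f : E →L[ℂ] E =>
      LinearMap.toMatrix b b (f : E →ₗ[ℂ] E) i j := by
    intro i j
    let φ : (E →L[ℂ] E) →ₗ[ℂ] ℂ :=
      { toFun := fun f => LinearMap.toMatrix b b (f : E →ₗ[ℂ] E) i j
        map_add' := by intro f g; simp [LinearMap.toMatrix_apply]
        map_smul' := by intro c f; simp [LinearMap.toMatrix_apply] }
    exact φ.toContinuousLinearMap.differentiable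
  rw [h]
  simp only [Matrix.det_apply]
  fun_prop

/-- The linear coefficient of the polynomial `det (1 + t G)` is `tr G`. -/
theorem hasDerivAt_det_one_add_smul (G : E →L[ℂ] E) :
    HasDerivAt (fun t : ℂ => LinearMap.det ((1 + t • G : E →L[ℂ] E) : E →ₗ[ℂ] E))
      (LinearMap.trace ℂ E G) 0 := by
  let b := Module.finBasis ℂ E
  set M := LinearMap.toMatrix b b (G : E →ₗ[ℂ] E) with hM
  have h : (fun t : ℂ => LinearMap.det ((1 + t • G : E →L[ℂ] E) : E →ₗ[ℂ] E)) = fun t : ℂ =>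
      1 + M.trace * t +
        (1 + (Polynomial.X : Polynomial ℂ) • M.map Polynomial.C).det.divX.divX.eval t * t ^ 2 := by
    funext t
    rw [← Matrix.det_one_add_smul, ← LinearMap.det_toMatrix b]
    congr 1
    ext i j
    simp [hM, LinearMap.toMatrix_apply, Matrix.one_apply, Finsupp.single_apply, eq_comm]
  rw [h, LinearMap.trace_eq_matrix_trace ℂ b, ← hM]
  set p := (1 + (Polynomial.X : Polynomial ℂ) • M.map Polynomial.C).det.divX.divX
  have h1 := (((hasDerivAt_id (0 : ℂ)).const_mul M.trace).const_add 1).add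
    ((p.hasDerivAt 0).mul (hasDerivAt_pow 2 (0 : ℂ)))
  exact h1.congr_deriv (by simp)

/-- The curves `1 + t G` and `e ^ (t G)` have the same tangent at `t = 0`, so that the differentiable
function `det` has the same derivative along both. -/
theorem hasDerivAt_det_exp_smul_zero (G : E →L[ℂ] E) :
    HasDerivAt (fun t : ℂ => LinearMap.det ((NormedSpace.exp (t • G) : E →L[ℂ] E) : E →ₗ[ℂ] E))
      (LinearMap.trace ℂ E G) 0 := by
  have hd := (differentiable_linearMap_det (E := E) 1).hasFDerivAt
  have hline : HasDerivAt (fun t : ℂ => 1 + t • G) G 0 := by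
    simpa using ((hasDerivAt_id (0 : ℂ)).smul_const G).const_add 1
  have hexp : HasDerivAt (fun t : ℂ => (NormedSpace.exp (t • G) : E →L[ℂ] E)) G 0 := by
    simpa using hasDerivAt_exp_smul_const (𝕂 := ℂ) G (0 : ℂ)
  have h1 := hd.comp_hasDerivAt_of_eq (0 : ℂ) hline (by simp)
  have h2 := hd.comp_hasDerivAt_of_eq (0 : ℂ) hexp (by simp)
  rwa [h1.unique (hasDerivAt_det_one_add_smul G)] at h2

/-- Both sides of `det e ^ (t G) = e ^ (t tr G)` solve the same linear differential equation,
because `t ↦ det e ^ (t G)` is multiplicative. -/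
theorem det_exp_eq_exp_trace (G : E →L[ℂ] E) :
    LinearMap.det ((NormedSpace.exp G : E →L[ℂ] E) : E →ₗ[ℂ] E) =
      Complex.exp (LinearMap.trace ℂ E G) := by
  set τ := LinearMap.trace ℂ E G
  set g : ℂ → ℂ := fun t => LinearMap.det ((NormedSpace.exp (t • G) : E →L[ℂ] E) : E →ₗ[ℂ] E)
    with hg
  have hmul : ∀ s t, g (s + t) = g s * g t := by
    intro s t
    let : NormedAlgebra ℚ (E →L[ℂ] E) := NormedAlgebra.restrictScalars ℚ ℂ _
    have : CompleteSpace E := FiniteDimensional.complete ℂ E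
    have := NormedSpace.exp_add_of_commute (x := s • G) (y := t • G)
      (((Commute.refl G).smul_left s).smul_right t)
    simp only [hg, add_smul, this, ContinuousLinearMap.toLinearMap_mul, map_mul]
  have hderiv : ∀ s, HasDerivAt g (g s * τ) s := by
    intro s
    have h0 : HasDerivAt g τ (s - s) := by
      simpa using hasDerivAt_det_exp_smul_zero G
    have h1 := (h0.comp_sub_const s s).const_mul (g s)
    have h2 : (fun t => g s * g (t - s)) = g := by
      funext t
      rw [← hmul, add_sub_cancel]
    rwa [h2] at h1
  have hconst : ∀ t, HasDerivAt (fun t => g t * Complex.exp (-(t * τ))) 0 t := by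
    intro t
    have h := (hderiv t).mul (((hasDerivAt_id t).mul_const τ).neg.cexp)
    refine h.congr_deriv ?_
    simp only [id, one_mul]
    ring
  have h := is_const_of_deriv_eq_zero (fun t => (hconst t).differentiableAt)
    (fun t => (hconst t).deriv) 1 0
  have hg0 : g 0 = 1 := by simp [hg]
  have hg1 : g 1 = LinearMap.det ((NormedSpace.exp G : E →L[ℂ] E) : E →ₗ[ℂ] E) := by simp [hg]
  rw [hg0, hg1] at h
  simp only [one_mul, zero_mul, neg_zero, Complex.exp_zero, mul_one, Complex.exp_neg] at h
  exact (mul_inv_eq_one₀ (Complex.exp_ne_zero _)).mp h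

end DetExp

/-! ### Generators whose dissipation is controlled by their trace -/

section TraceBounded

variable {E : Type*} [NormedAddCommGroup E] [InnerProductSpace ℂ E]

/-- The trace of `G` is real and the real part of the numerical range of `G` is bounded below by
`k` times that trace. For Lindblad generators on `d × d` matrices this holds with `k = 2 / d`. -/
def IsTraceBounded (k : ℝ) (G : E →L[ℂ] E) : Prop :=
  (LinearMap.trace ℂ E G).im = 0 ∧
    ∀ x, k * (LinearMap.trace ℂ E G).re * ‖x‖ ^ 2 ≤ (⟪x, G x⟫_ℂ).re

theorem IsTraceBounded.zero (k : ℝ) : IsTraceBounded k (0 : E →L[ℂ] E) := by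
  simp [IsTraceBounded]

theorem IsTraceBounded.add {k : ℝ} {F G : E →L[ℂ] E} (hF : IsTraceBounded k F)
    (hG : IsTraceBounded k G) : IsTraceBounded k (F + G) := by
  refine ⟨by simp [hF.1, hG.1], fun x => ?_⟩
  have h1 := hF.2 x
  have h2 := hG.2 x
  simp only [ContinuousLinearMap.toLinearMap_add, map_add, Complex.add_re,
    add_apply, inner_add_right]
  linarith

theorem IsTraceBounded.sum {ι : Type*} {k : ℝ} (s : Finset ι) {G : ι → E →L[ℂ] E}
    (hG : ∀ i ∈ s, IsTraceBounded k (G i)) : IsTraceBounded k (∑ i ∈ s, G i) :=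
  Finset.sum_induction G (IsTraceBounded k) (fun _ _ => IsTraceBounded.add)
    (IsTraceBounded.zero k) hG

/-- If the numerical range of `G` lies to the right of `r`, then `e ^ (-2 r t) ‖e ^ (t G) x‖ ^ 2`
is nondecreasing in `t`. -/
theorem exp_mul_norm_le_norm_exp_apply [CompleteSpace E] {r : ℝ} {G : E →L[ℂ] E}
    (hG : ∀ x, r * ‖x‖ ^ 2 ≤ (⟪x, G x⟫_ℂ).re) (x : E) :
    Real.exp r * ‖x‖ ≤ ‖NormedSpace.exp G x‖ := by
  let : InnerProductSpace ℝ E := InnerProductSpace.rclikeToReal ℂ E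
  set u : ℝ → E := fun t => NormedSpace.exp (t • G) x with hu
  have hu' : ∀ t, HasDerivAt u (G (u t)) t := by
    intro t
    have h := hasDerivAt_exp_smul_const' (𝕂 := ℝ) G t
    exact ((ContinuousLinearMap.apply ℂ E x).restrictScalars ℝ).hasFDerivAt.comp_hasDerivAt t h
  have hn : ∀ t, HasDerivAt (fun t => ‖u t‖ ^ 2) (2 * (⟪u t, G (u t)⟫_ℂ).re) t :=
    fun t => (hu' t).norm_sq
  set w : ℝ → ℝ := fun t => ‖u t‖ ^ 2 * Real.exp (-(t * (2 * r))) with hw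
  have hw' : ∀ t, HasDerivAt w
      ((2 * (⟪u t, G (u t)⟫_ℂ).re - 2 * r * ‖u t‖ ^ 2) * Real.exp (-(t * (2 * r)))) t := by
    intro t
    have he : HasDerivAt (fun t : ℝ => -(t * (2 * r))) (-(1 * (2 * r))) t :=
      ((hasDerivAt_id t).mul_const (2 * r)).neg
    exact ((hn t).mul he.exp).congr_deriv (by ring)
  have hmono : Monotone w := monotone_of_hasDerivAt_nonneg hw' fun t =>
    mul_nonneg (by have := hG (u t); linarith) (Real.exp_pos _).le
  have h := hmono zero_le_one
  have h0 : u 0 = x := by simp [hu]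
  have h1 : u 1 = NormedSpace.exp G x := by simp [hu]
  simp only [hw, h0, h1, zero_mul, neg_zero, Real.exp_zero, mul_one, one_mul] at h
  rw [Real.exp_neg, ← div_eq_mul_inv, le_div_iff₀ (Real.exp_pos _), two_mul, Real.exp_add] at h
  refine le_of_sq_le_sq ?_ (norm_nonneg _)
  linarith

/-- The maps `T` with `det T ≥ 0` which shrink no vector by a factor below `(det T) ^ k`. -/
def detContractionBounded (E : Type*) [NormedAddCommGroup E] [InnerProductSpace ℂ E] (k : ℝ) :
    Set (E →L[ℂ] E) :=
  {T | 0 ≤ LinearMap.det (T : E →ₗ[ℂ] E) ∧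
    ∀ x, (LinearMap.det (T : E →ₗ[ℂ] E)).re ^ k * ‖x‖ ≤ ‖T x‖}

theorem one_mem_detContractionBounded (k : ℝ) : 1 ∈ detContractionBounded E k := by
  simp [detContractionBounded]

theorem mul_mem_detContractionBounded {k : ℝ} {S T : E →L[ℂ] E}
    (hS : S ∈ detContractionBounded E k) (hT : T ∈ detContractionBounded E k) :
    S * T ∈ detContractionBounded E k := by
  have hdet : LinearMap.det ((S * T : E →L[ℂ] E) : E →ₗ[ℂ] E) =
      LinearMap.det (S : E →ₗ[ℂ] E) * LinearMap.det (T : E →ₗ[ℂ] E) := by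
    rw [ContinuousLinearMap.toLinearMap_mul, map_mul]
  obtain ⟨hS0, hS1⟩ := hS
  obtain ⟨hT0, hT1⟩ := hT
  have hSre := (Complex.nonneg_iff.mp hS0).1
  have hTre := (Complex.nonneg_iff.mp hT0).1
  have hTim := (Complex.nonneg_iff.mp hT0).2
  refine ⟨by rw [hdet]; exact mul_nonneg hS0 hT0, fun x => ?_⟩
  rw [hdet, Complex.mul_re, ← hTim, mul_zero, sub_zero, Real.mul_rpow hSre hTre, mul_assoc]
  calc _ ≤ _ * ‖T x‖ := mul_le_mul_of_nonneg_left (hT1 x) (Real.rpow_nonneg hSre k)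
    _ ≤ ‖S (T x)‖ := hS1 (T x)

variable [FiniteDimensional ℂ E]

theorem isClosed_detContractionBounded {k : ℝ} (hk : 0 ≤ k) :
    IsClosed (detContractionBounded E k) := by
  have hdet : Continuous fun T : E →L[ℂ] E => LinearMap.det (T : E →ₗ[ℂ] E) :=
    differentiable_linearMap_det.continuous
  rw [detContractionBounded, Set.ofPred_and, Set.ofPred_forall]
  refine (isClosed_le continuous_const hdet).inter ?_
  refine isClosed_iInter fun x => isClosed_le ?_ (by fun_prop)
  exact ((Complex.continuous_re.comp hdet).rpow_const fun _ => Or.inr hk).mul continuous_const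

theorem IsTraceBounded.exp_mem {k : ℝ} {G : E →L[ℂ] E} (hG : IsTraceBounded k G) :
    NormedSpace.exp G ∈ detContractionBounded E k := by
  have : CompleteSpace E := FiniteDimensional.complete ℂ E
  have hreal : LinearMap.trace ℂ E G = ((LinearMap.trace ℂ E G).re : ℂ) :=
    Complex.ext rfl (by simpa using hG.1)
  have hdet : LinearMap.det ((NormedSpace.exp G : E →L[ℂ] E) : E →ₗ[ℂ] E) =
      (Real.exp (LinearMap.trace ℂ E G).re : ℂ) := by
    rw [det_exp_eq_exp_trace, Complex.ofReal_exp, ← hreal]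
  refine ⟨?_, fun x => ?_⟩
  · rw [hdet]
    exact_mod_cast (Real.exp_pos _).le
  · rw [hdet, Complex.ofReal_re, ← Real.exp_mul, mul_comm _ k]
    exact exp_mul_norm_le_norm_exp_apply hG.2 x

theorem infinitesimalDivisible_subset {k : ℝ} (hk : 0 ≤ k) {𝒢 : Set (E →L[ℂ] E)}
    (h𝒢 : ∀ G ∈ 𝒢, IsTraceBounded k G) :
    infinitesimalDivisible 𝒢 ⊆ detContractionBounded E k := by
  refine closure_minimal ?_ (isClosed_detContractionBounded hk)
  intro T hT
  obtain ⟨n, G, hG, -, rfl⟩ := hT 1 one_pos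
  refine List.prod_induction (· ∈ detContractionBounded E k)
    (fun _ _ => mul_mem_detContractionBounded)
    (one_mem_detContractionBounded k) fun S hS => ?_
  obtain ⟨j, rfl⟩ := (List.mem_ofFn' _ _).mp hS
  exact (h𝒢 _ (hG j)).exp_mem

end TraceBounded

/-! ### Lindblad generators -/

section Lindblad

variable {d : ℕ}

theorem norm_vectorize (A : Matrix (Fin d) (Fin d) ℂ) : ‖vectorize d A‖ = ‖A‖ := by
  rw [Matrix.frobenius_norm_def, EuclideanSpace.norm_eq, Real.sqrt_eq_rpow, Fintype.sum_prod_type]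
  simp only [Real.rpow_two]
  rfl

@[simp]
theorem toHilbertSchmidt_vectorize (L : Superoperator d) (X : Matrix (Fin d) (Fin d) ℂ) :
    toHilbertSchmidt L (vectorize d X) = vectorize d (L X) := by
  simp [toHilbertSchmidt, LinearEquiv.conj_apply]

theorem trace_toHilbertSchmidt (L : Superoperator d) :
    LinearMap.trace ℂ (HilbertSchmidt d) (toHilbertSchmidt L) = LinearMap.trace ℂ _ L :=
  LinearMap.trace_conj' L (vectorize d)

theorem isTraceBounded_toHilbertSchmidt {k : ℝ} {L : Superoperator d}
    (him : (LinearMap.trace ℂ _ L).im = 0)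
    (hle : ∀ X : Matrix (Fin d) (Fin d) ℂ,
      k * (LinearMap.trace ℂ _ L).re * ‖X‖ ^ 2 ≤ (Xᴴ * L X).trace.re) :
    IsTraceBounded k (toHilbertSchmidt L) := by
  refine ⟨by rwa [trace_toHilbertSchmidt], fun x => ?_⟩
  obtain ⟨X, rfl⟩ := (vectorize d).surjective x
  rw [trace_toHilbertSchmidt, norm_vectorize, toHilbertSchmidt_vectorize, inner_vectorize]
  exact hle X

/-- The map `ρ ↦ B ρ C`. -/
def sandwich (B C : Matrix (Fin d) (Fin d) ℂ) : Superoperator d :=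
  LinearMap.mulLeft ℂ B ∘ₗ LinearMap.mulRight ℂ C

@[simp]
theorem sandwich_apply (B C X : Matrix (Fin d) (Fin d) ℂ) : sandwich B C X = B * X * C := by
  simp [sandwich, mul_assoc]

theorem trace_sandwich (B C : Matrix (Fin d) (Fin d) ℂ) :
    LinearMap.trace ℂ _ (sandwich B C) = B.trace * C.trace := by
  rw [LinearMap.trace_eq_matrix_trace ℂ (Matrix.stdBasis ℂ (Fin d) (Fin d)), Matrix.trace,
    Fintype.sum_prod_type, Matrix.trace, Matrix.trace, Finset.sum_mul_sum]
  refine Finset.sum_congr rfl fun i _ => Finset.sum_congr rfl fun j _ => ?_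
  rw [Matrix.diag_apply, LinearMap.toMatrix_apply, Matrix.stdBasis_eq_single, sandwich_apply]
  -- the coordinates in the standard basis are the entries
  change (B * Matrix.single i j 1 * C : Matrix (Fin d) (Fin d) ℂ) i j = _
  rw [Matrix.mul_apply, Finset.sum_eq_single j]
  · rw [Matrix.mul_single_apply_same, mul_one, Matrix.diag_apply, Matrix.diag_apply]
  · intro k _ hk
    rw [Matrix.mul_single_apply_of_ne _ _ _ _ _ hk, zero_mul]
  · simp

theorem dissipator_eq_sandwich (A : Matrix (Fin d) (Fin d) ℂ) :
    dissipator A = sandwich A Aᴴ - (1 / 2 : ℂ) • (sandwich (Aᴴ * A) 1 + sandwich 1 (Aᴴ * A)) := by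
  ext1 X
  simp [dissipator]

theorem trace_conjTranspose_mul_self (A : Matrix (Fin d) (Fin d) ℂ) :
    (Aᴴ * A).trace = ((‖A‖ ^ 2 : ℝ) : ℂ) := by
  rw [← inner_vectorize, inner_self_eq_norm_sq_to_K, norm_vectorize]
  norm_cast

theorem trace_dissipator (A : Matrix (Fin d) (Fin d) ℂ) :
    LinearMap.trace ℂ _ (dissipator A) =
      ((‖A.trace‖ ^ 2 - d * ‖A‖ ^ 2 : ℝ) : ℂ) := by
  rw [dissipator_eq_sandwich]
  simp only [map_sub, map_smul, map_add, trace_sandwich, Matrix.trace_one, Fintype.card_fin,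
    trace_conjTranspose_mul_self, Matrix.trace_conjTranspose, smul_eq_mul]
  have : A.trace * star A.trace = ((‖A.trace‖ ^ 2 : ℝ) : ℂ) := by
    rw [Complex.star_def, Complex.mul_conj, Complex.normSq_eq_norm_sq]
  rw [this]
  push_cast
  ring

/-- Both the jump term and the two halves of the anticommutator term are bounded by
`‖A‖ ^ 2 * ‖X‖`, as the Frobenius norm is submultiplicative. -/
theorem norm_dissipator_apply_le (A X : Matrix (Fin d) (Fin d) ℂ) :
    ‖dissipator A X‖ ≤ 2 * ‖A‖ ^ 2 * ‖X‖ := by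
  have hA : ‖Aᴴ‖ = ‖A‖ := Matrix.frobenius_norm_conjTranspose A
  have hAA : ‖Aᴴ * A‖ ≤ ‖A‖ * ‖A‖ := by
    simpa [hA] using Matrix.frobenius_norm_mul Aᴴ A
  have h1 : ‖A * X * Aᴴ‖ ≤ ‖A‖ ^ 2 * ‖X‖ := by
    calc _ ≤ ‖A * X‖ * ‖Aᴴ‖ := Matrix.frobenius_norm_mul _ _
      _ ≤ (‖A‖ * ‖X‖) * ‖A‖ := by
        rw [hA]; gcongr; exact Matrix.frobenius_norm_mul _ _
      _ = _ := by ring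
  have h2 : ‖Aᴴ * A * X‖ ≤ ‖A‖ ^ 2 * ‖X‖ := by
    calc _ ≤ ‖Aᴴ * A‖ * ‖X‖ := Matrix.frobenius_norm_mul _ _
      _ ≤ (‖A‖ * ‖A‖) * ‖X‖ := by gcongr
      _ = _ := by ring
  have h3 : ‖X * (Aᴴ * A)‖ ≤ ‖A‖ ^ 2 * ‖X‖ := by
    calc _ ≤ ‖X‖ * ‖Aᴴ * A‖ := Matrix.frobenius_norm_mul _ _
      _ ≤ ‖X‖ * (‖A‖ * ‖A‖) := by gcongr
      _ = _ := by ring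
  calc ‖A * X * Aᴴ - (1 / 2 : ℂ) • (Aᴴ * A * X + X * (Aᴴ * A))‖
      ≤ ‖A * X * Aᴴ‖ + ‖(1 / 2 : ℂ)‖ * (‖Aᴴ * A * X‖ + ‖X * (Aᴴ * A)‖) := by
        refine (norm_sub_le _ _).trans ?_
        rw [norm_smul]
        gcongr
        exact norm_add_le _ _
    _ ≤ ‖A‖ ^ 2 * ‖X‖ + ‖(1 / 2 : ℂ)‖ * (‖A‖ ^ 2 * ‖X‖ + ‖A‖ ^ 2 * ‖X‖) := by gcongr
    _ = _ := by norm_num; ring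

theorem neg_le_re_trace_mul_dissipator (A X : Matrix (Fin d) (Fin d) ℂ) :
    -(2 * ‖A‖ ^ 2 * ‖X‖ ^ 2) ≤ (Xᴴ * dissipator A X).trace.re := by
  have h : ‖(Xᴴ * dissipator A X).trace‖ ≤ ‖X‖ * (2 * ‖A‖ ^ 2 * ‖X‖) := by
    rw [← inner_vectorize]
    refine (norm_inner_le_norm _ _).trans ?_
    rw [norm_vectorize, norm_vectorize]
    gcongr
    exact norm_dissipator_apply_le A X
  have := (abs_le.mp ((Complex.abs_re_le_norm _).trans h)).1
  linarith

theorem isTraceBounded_dissipator_of_trace_eq_zero (hd : 1 ≤ d)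
    {A : Matrix (Fin d) (Fin d) ℂ} (hA : A.trace = 0) :
    IsTraceBounded (2 / d) (toHilbertSchmidt (dissipator A)) := by
  have hd' : (d : ℝ) ≠ 0 := by positivity
  refine isTraceBounded_toHilbertSchmidt (by rw [trace_dissipator, Complex.ofReal_im]) fun X => ?_
  refine le_of_eq_of_le ?_ (neg_le_re_trace_mul_dissipator A X)
  rw [trace_dissipator, Complex.ofReal_re, hA]
  field_simp
  simp

/-- The commutator map `ρ ↦ K ρ - ρ K`. -/
def commutatorMap (K : Matrix (Fin d) (Fin d) ℂ) : Superoperator d :=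
  sandwich K 1 - sandwich 1 K

@[simp]
theorem commutatorMap_apply (K X : Matrix (Fin d) (Fin d) ℂ) :
    commutatorMap K X = K * X - X * K := by
  simp [commutatorMap]

theorem re_trace_eq_zero_of_conjTranspose_eq_neg {M : Matrix (Fin d) (Fin d) ℂ} (hM : Mᴴ = -M) :
    M.trace.re = 0 := by
  have h := congrArg Complex.re (Matrix.trace_conjTranspose M)
  simp [hM] at h
  linarith

theorem isTraceBounded_commutatorMap (k : ℝ) {K : Matrix (Fin d) (Fin d) ℂ} (hK : Kᴴ = -K) :
    IsTraceBounded k (toHilbertSchmidt (commutatorMap K)) := by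
  have htr : LinearMap.trace ℂ _ (commutatorMap K) = 0 := by
    simp [commutatorMap, trace_sandwich, mul_comm]
  refine isTraceBounded_toHilbertSchmidt (by simp [htr]) fun X => ?_
  have h1 : (Xᴴ * (K * X)).trace.re = 0 :=
    re_trace_eq_zero_of_conjTranspose_eq_neg (by simp [hK, mul_assoc])
  have h2 : (Xᴴ * (X * K)).trace.re = 0 := by
    rw [Matrix.trace_mul_comm]
    exact re_trace_eq_zero_of_conjTranspose_eq_neg (by simp [hK, mul_assoc])
  simp [htr, mul_sub, h1, h2]

/-- Shifting `A` by a multiple of the identity changes the dissipator by the commutator with a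
skew-adjoint matrix only. -/
theorem dissipator_add_smul_one (A : Matrix (Fin d) (Fin d) ℂ) (z : ℂ) :
    dissipator (A + z • 1) =
      dissipator A + commutatorMap ((1 / 2 : ℂ) • (star z • A - z • Aᴴ)) := by
  ext1 X
  simp [dissipator, add_mul, mul_add, sub_mul, mul_sub, smul_sub, smul_add, smul_smul]
  module

theorem isTraceBounded_dissipator (hd : 1 ≤ d) (A : Matrix (Fin d) (Fin d) ℂ) :
    IsTraceBounded (2 / d) (toHilbertSchmidt (dissipator A)) := by
  have hd' : (d : ℂ) ≠ 0 := by exact_mod_cast (by omega : d ≠ 0)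
  -- subtracting this multiple of the identity leaves the traceless part of `A`
  set z := A.trace / d with hz
  have h0 : (A - z • 1).trace = 0 := by
    simp [hz, hd']
  have h := dissipator_add_smul_one (A - z • 1) z
  rw [sub_add_cancel] at h
  have hadd : ∀ L M : Superoperator d,
      toHilbertSchmidt (L + M) = toHilbertSchmidt L + toHilbertSchmidt M := by
    intro L M
    simp [toHilbertSchmidt]
  rw [h, hadd]
  refine (isTraceBounded_dissipator_of_trace_eq_zero hd h0).add
    (isTraceBounded_commutatorMap _ ?_)
  simp only [Matrix.conjTranspose_smul, Matrix.conjTranspose_sub, Matrix.conjTranspose_conjTranspose,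
    star_star, ← smul_neg, neg_sub]
  simp

end Lindblad

/-! ### Spectral consequences -/

section Spectral

variable {E : Type*} [NormedAddCommGroup E] [InnerProductSpace ℂ E] [FiniteDimensional ℂ E]

theorem exists_norm_apply_eq_singularValues_mul_norm (T : E →ₗ[ℂ] E) {n : ℕ}
    (hn : n < Module.finrank ℂ E) : ∃ x ≠ 0, ‖T x‖ = T.singularValues n * ‖x‖ := by
  obtain ⟨x, hx⟩ := (T.hasEigenvalue_adjoint_comp_self_sq_singularValues hn).exists_hasEigenvector
  refine ⟨x, hx.2, ?_⟩
  rw [← sq_eq_sq₀ (norm_nonneg _) (mul_nonneg (T.singularValues_nonneg n) (norm_nonneg _)), mul_pow]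
  have h := hx.apply_eq_smul
  have h2 : ⟪x, (LinearMap.adjoint T ∘ₗ T) x⟫_ℂ = ⟪T x, T x⟫_ℂ := by
    rw [LinearMap.comp_apply, LinearMap.adjoint_inner_right]
  rw [h, inner_smul_right, inner_self_eq_norm_sq_to_K, inner_self_eq_norm_sq_to_K] at h2
  have h3 : ((T.singularValues n ^ 2 * ‖x‖ ^ 2 : ℝ) : ℂ) = ((‖T x‖ ^ 2 : ℝ) : ℂ) := by
    push_cast
    exact h2
  exact (Complex.ofReal_injective h3).symm

theorem trace_adjoint_eq_conj (T : E →ₗ[ℂ] E) :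
    LinearMap.trace ℂ E (LinearMap.adjoint T) = star (LinearMap.trace ℂ E T) := by
  rw [LinearMap.trace_eq_sum_inner _ (stdOrthonormalBasis ℂ E),
    LinearMap.trace_eq_sum_inner _ (stdOrthonormalBasis ℂ E), star_sum]
  refine Finset.sum_congr rfl fun i _ => ?_
  rw [LinearMap.adjoint_inner_right, Complex.star_def, inner_conj_symm]

theorem re_inner_add_adjoint_apply_self (T : E →ₗ[ℂ] E) (x : E) :
    (⟪x, (T + LinearMap.adjoint T) x⟫_ℂ).re = 2 * (⟪x, T x⟫_ℂ).re := by
  rw [LinearMap.add_apply, inner_add_right, LinearMap.adjoint_inner_right, ← inner_conj_symm (T x),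
    Complex.add_re, Complex.conj_re, two_mul]

theorem exists_isLeast_hasEigenvalue [Nontrivial E] {T : E →ₗ[ℂ] E} (hT : T.IsSymmetric) :
    ∃ lam : ℝ, IsLeast {x : ℝ | Module.End.HasEigenvalue T (x : ℂ)} lam := by
  have hfin : {x : ℝ | Module.End.HasEigenvalue T (x : ℂ)}.Finite :=
    (Module.End.finite_hasEigenvalue T).preimage Complex.ofReal_injective.injOn
  obtain ⟨a, ha, hmin⟩ := Set.exists_min_image _ id hfin
    ⟨_, hT.hasEigenvalue_iInf_of_finiteDimensional⟩
  exact ⟨a, ha, hmin⟩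

theorem isSymmetric_add_adjoint (T : E →ₗ[ℂ] E) : (T + LinearMap.adjoint T).IsSymmetric := by
  intro x y
  simp only [LinearMap.add_apply, inner_add_left, inner_add_right, LinearMap.adjoint_inner_left,
    LinearMap.adjoint_inner_right]
  ring

theorem IsTraceBounded.trace_add_adjoint_le {k : ℝ} (hk : 0 < k) {G : E →L[ℂ] E}
    (hG : IsTraceBounded k G) {lam : ℝ}
    (hlam : Module.End.HasEigenvalue (G.toLinearMap + LinearMap.adjoint G.toLinearMap) (lam : ℂ)) :
    LinearMap.trace ℂ E (G.toLinearMap + LinearMap.adjoint G.toLinearMap) ≤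
      ((k⁻¹ * lam : ℝ) : ℂ) := by
  obtain ⟨x, hx⟩ := hlam.exists_hasEigenvector
  have hpos : 0 < ‖x‖ ^ 2 := by
    have := norm_pos_iff.mpr hx.2
    positivity
  have h := re_inner_add_adjoint_apply_self G.toLinearMap x
  rw [hx.apply_eq_smul, inner_smul_right, inner_self_eq_norm_sq_to_K] at h
  have h1 : lam * ‖x‖ ^ 2 = 2 * (⟪x, G x⟫_ℂ).re := by
    rw [← Complex.ofReal_re (lam * ‖x‖ ^ 2)]
    push_cast
    exact h
  have h2 : 2 * (k * (LinearMap.trace ℂ E G).re) ≤ lam := by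
    refine le_of_mul_le_mul_right ?_ hpos
    linarith [hG.2 x]
  rw [map_add, trace_adjoint_eq_conj, Complex.star_def, Complex.add_conj, Complex.real_le_real,
    le_inv_mul_iff₀ hk]
  linarith

end Spectral

theorem det_le_singularValueUp_rpow {d : ℕ} (hd : 1 ≤ d) {T : Superoperator d}
    (hT : toHilbertSchmidt T ∈ detContractionBounded (HilbertSchmidt d) (2 / d)) :
    0 ≤ LinearMap.det T ∧ LinearMap.det T ≤ ((singularValueUp T 1 ^ ((d : ℝ) / 2) : ℝ) : ℂ) := by
  have hdet : LinearMap.det (toHilbertSchmidt T).toLinearMap = LinearMap.det T :=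
    LinearMap.det_conj T (vectorize d)
  obtain ⟨h0, h1⟩ := hT
  rw [hdet] at h0 h1
  refine ⟨h0, ?_⟩
  have hd0 : (0 : ℝ) < d := by exact_mod_cast hd
  have hrank : d ^ 2 - 1 < Module.finrank ℂ (HilbertSchmidt d) := by
    have : 0 < d ^ 2 := by positivity
    simp only [finrank_euclideanSpace, Fintype.card_prod, Fintype.card_fin, ← sq]
    omega
  obtain ⟨x, hx, hσ⟩ :=
    exists_norm_apply_eq_singularValues_mul_norm (toHilbertSchmidt T).toLinearMap hrank
  have hle : (LinearMap.det T).re ^ (2 / (d : ℝ)) ≤ singularValueUp T 1 :=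
    le_of_mul_le_mul_right ((h1 x).trans_eq hσ) (norm_pos_iff.mpr hx)
  obtain ⟨hre, him⟩ := Complex.nonneg_iff.mp h0
  have hreal : LinearMap.det T = ((LinearMap.det T).re : ℂ) :=
    Complex.ext rfl (by simpa using him.symm)
  rw [hreal, Complex.real_le_real]
  have h := Real.rpow_le_rpow (Real.rpow_nonneg hre _) hle (by positivity : 0 ≤ (d : ℝ) / 2)
  rwa [← Real.rpow_mul hre, div_mul_div_cancel₀ hd0.ne', div_self two_ne_zero, Real.rpow_one] at h

theorem isTraceBounded_lindbladGenerator {d : ℕ} (hd : 1 ≤ d) {L : Superoperator d}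
    (hL : IsLindbladGenerator L) : IsTraceBounded (2 / d) (toHilbertSchmidt L) := by
  obtain ⟨H, n, A, hH, hL⟩ := hL
  have h : toHilbertSchmidt L = toHilbertSchmidt (commutatorMap (-(Complex.I • H))) +
      ∑ j, toHilbertSchmidt (dissipator (A j)) := by
    have hL' : L = commutatorMap (-(Complex.I • H)) + ∑ j, dissipator (A j) := by
      ext1 ρ
      rw [hL]
      simp [sub_eq_add_neg, add_comm]
    rw [hL']
    simp [toHilbertSchmidt]
  rw [h]
  exact (isTraceBounded_commutatorMap _ (by simp [Matrix.conjTranspose_smul, hH.eq])).add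
    (IsTraceBounded.sum _ fun j _ => isTraceBounded_dissipator hd (A j))

theorem corollary4p7 (d : ℕ) (hd : 1 ≤ d) :
    (∀ T : Superoperator d, IsInfinitesimalMarkovianDivisible T →
      0 ≤ LinearMap.det T ∧
        LinearMap.det T ≤ ((singularValueUp T 1 ^ ((d : ℝ) / 2) : ℝ) : ℂ)) ∧
    (∀ A : Matrix (Fin d) (Fin d) ℂ, ∃ lam : ℝ,
      IsLeast {x : ℝ | Module.End.HasEigenvalue (addAdjoint (dissipator A)) (x : ℂ)} lam ∧
        LinearMap.trace ℂ (HilbertSchmidt d) (addAdjoint (dissipator A)) ≤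
          (((d : ℝ) / 2 * lam : ℝ) : ℂ)) := by
  have hd0 : (0 : ℝ) < d := by exact_mod_cast hd
  refine ⟨fun T hT => det_le_singularValueUp_rpow hd ?_, fun A => ?_⟩
  · refine infinitesimalDivisible_subset (by positivity) ?_ hT
    rintro _ ⟨L, hL, rfl⟩
    exact isTraceBounded_lindbladGenerator hd hL
  · have : Nonempty (Fin d) := ⟨⟨0, hd⟩⟩
    obtain ⟨lam, hlam⟩ := exists_isLeast_hasEigenvalue
      (isSymmetric_add_adjoint (toHilbertSchmidt (dissipator A)).toLinearMap)
    refine ⟨lam, hlam, ?_⟩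
    have h := (isTraceBounded_dissipator hd A).trace_add_adjoint_le (by positivity) hlam.1
    rwa [inv_div] at h
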